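/- There are universal constants $C>0$ and $k\in\mathbb{N}$ such that the following holds. Let $d\ge 1$, and let $\mathcal{D}$ be a probability distribution over $\{\mathbf{x}\in\mathbb{R}^d:\|\mathbf{x}\|\le 1\}\times\{-1,+1\}$ ($\|\cdot\|$ is the Euclidean norm) for which there exist a unit vector $\mathbf{w}^*\in\mathbb{R}^d$ and $\gamma>0$ with $\Pr_{(\mathbf{x},y)\sim\mathcal{D}}(y\,\mathbf{x}^\top\mathbf{w}^*\ge\gamma)=1$. Let $m\ge 1$ and $\delta\in(0,1)$, sample $(\mathbf{x}_1,y_1),\ldots,(\mathbf{x}_m,y_m)$ i.i.d. from $\mathcal{D}$, and run gradient descent with step size $1$ from the origin on the empirical risk with the logistic loss $\ell(z)=\log(1+e^{-z})$: $$\hat L(\mathbf{w})=\frac1m\sum_{i=1}^m\ell(y_i\mathbf{x}_i^\top\mathbf{w}),\qquad \mathbf{w}_0=\mathbf{0},\qquad \mathbf{w}_{t+1}=\mathbf{w}_t-\nabla\hat L(\mathbf{w}_t)\quad(t\ge0).$$ Then, with probability at least $1-\delta$ over the sample, it holds simultaneously for all iterations $T\ge 1$ that $$\Pr_{(\mathbf{x},y)\sim\mathcal{D}}\big(\mathrm{sign}(\mathbf{x}^\top\mathbf{w}_T)\ne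 y\big)\;\le\; C\,\Big(\log(e+\gamma^2m)\,\log(e+T)\,\log(e+1/\delta)\Big)^{k}\left(\frac{1}{\gamma^2T}+\frac{1}{\gamma^2m}\right),$$ where $\mathrm{sign}(0)=0$, so that $\mathbf{x}^\top\mathbf{w}_T=0$ counts as an error. In other words, the error is $\tilde{\mathcal O}\big(\frac{1}{\gamma^2T}+\frac{1}{\gamma^2m}\big)$, where $\tilde{\mathcal O}$ hides universal constants and factors polylogarithmic in $\gamma^2m$, $T$ and $1/\delta$. -/

import Mathlib

open MeasureTheory

noncomputable section

/-- The logistic loss `ℓ(z) = log (1 + exp (-z))`. -/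
def logisticLoss (z : ℝ) : ℝ := Real.log (1 + Real.exp (-z))

/-- The logistic empirical risk `w ↦ (1/m) ∑ i, ℓ(yᵢ ⟨xᵢ, w⟩)` of the labelled sample
`S i = (xᵢ, yᵢ)`. -/
def logisticEmpiricalRisk {d m : ℕ} (S : Fin m → EuclideanSpace ℝ (Fin d) × ℝ)
    (w : EuclideanSpace ℝ (Fin d)) : ℝ :=
  (1 / (m : ℝ)) * ∑ i, logisticLoss ((S i).2 * inner ℝ (S i).1 w)

/-- The iterates `w (t + 1) = w t - η t • ∇ f (w t)` of gradient descent on `f` with step sizes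
`η`, started at `w 0 = start`. -/
def gradientDescent {d : ℕ} (f : EuclideanSpace ℝ (Fin d) → ℝ) (η : ℕ → ℝ)
    (start : EuclideanSpace ℝ (Fin d)) : ℕ → EuclideanSpace ℝ (Fin d)
  | 0 => start
  | t + 1 => gradientDescent f η start t - η t • gradient f (gradientDescent f η start t)

/-- The 0-1 generalization error `Pr_{(x,y) ∼ D} (sign ⟨x, w⟩ ≠ y)`. Here `sign 0 = 0`, so a point
with `⟨x, w⟩ = 0` counts as an error whatever its label in `{-1, 1}`. -/
def zeroOneError {d : ℕ} (D : Measure (EuclideanSpace ℝ (Fin d) × ℝ))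
    (w : EuclideanSpace ℝ (Fin d)) : ℝ :=
  D.real {z | Real.sign (inner ℝ z.1 w) ≠ z.2}

end

/-!
The proof combines an optimization bound for gradient descent with a PAC-Bayes bound that holds for
all linear classifiers at once, so that no union bound over the iterations is needed.

*Optimization.* The logistic loss is convex, smooth and self-bounding (its slope is at most the
loss), so gradient descent with step size `1` decreases the risk and satisfies a regret bound
against every comparator `u` (`gradientDescent_regret`). With `u = (log (e + T) / γ) • w₀`, whose
risk is at most `1 / T` on separable data, this gives risk `O(log² (e + T) / (γ² T))` and
`‖w_T‖² = O(log² (e + T) / γ²)` for the `T`-th iterate (`gradientDescent_separable`).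

*Generalization.* For a fixed classifier `v` with error probability `p`, the number `N` of errors on
the sample satisfies `𝔼 exp ((1 - e⁻¹) m p - N) ≤ 1`. Averaging over a standard Gaussian prior on `v`
and applying Markov's inequality bounds the prior average by `1 / δ` with probability at least
`1 - δ` (`measureReal_exp_riskGap_ge_le`). In that event Jensen's inequality and the Cameron–Martin
formula (`exp_integral_shift_le`) transfer the comparison to the Gaussian centred at `c • w`, for
every `w` at once, at the price `c² ‖w‖² / 2`. A point misclassified by `w` is misclassified by the
Gaussian classifier with probability at least `1 / 2`, whereas a sample point of margin at least `1`
is misclassified with probability at most `exp (-c² / 2)`, and the remaining sample points number at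
most `4 m` times the logistic risk (`zeroOneError_le_of_riskGap`). The choice
`c² = 2 log (e + γ² m)` makes the bound independent of the dimension and of `m` other than through
`γ² m`.
-/

/-! ### The logistic loss -/

/-- A function with monotone derivative lies above its tangents. -/
lemma le_of_hasDerivAt_of_monotone {f f' : ℝ → ℝ} (hf : ∀ x, HasDerivAt f (f' x) x)
    (hmono : Monotone f') (t u : ℝ) : f t + f' t * (u - t) ≤ f u := by
  have hc : Continuous f := continuous_iff_continuousAt.2 fun x => (hf x).continuousAt
  rcases lt_trichotomy t u with h | rfl | h
  · obtain ⟨c, hc, hs⟩ := exists_hasDerivAt_eq_slope f f' h hc.continuousOn fun x _ => hf x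
    have h1 := hmono hc.1.le
    rw [hs, le_div_iff₀ (by linarith)] at h1
    linarith
  · simp
  · obtain ⟨c, hc, hs⟩ := exists_hasDerivAt_eq_slope f f' h hc.continuousOn fun x _ => hf x
    have h1 := hmono hc.2.le
    rw [hs, div_le_iff₀ (by linarith)] at h1
    linarith

/-- The negated derivative `t ↦ 1 / (1 + exp t)` of the logistic loss. -/
noncomputable def logisticSlope (t : ℝ) : ℝ := 1 / (1 + Real.exp t)

lemma hasDerivAt_logisticLoss (t : ℝ) : HasDerivAt logisticLoss (-logisticSlope t) t := by
  have h : HasDerivAt (fun z : ℝ => 1 + Real.exp (-z)) (Real.exp (-t) * (-1)) t :=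
    ((hasDerivAt_neg t).exp).const_add 1
  refine (h.log (by positivity)).congr_deriv ?_
  unfold logisticSlope
  rw [Real.exp_neg]
  field_simp
  ring

lemma logisticSlope_pos (t : ℝ) : 0 < logisticSlope t := by
  unfold logisticSlope; positivity

lemma logisticSlope_le_one (t : ℝ) : logisticSlope t ≤ 1 := by
  unfold logisticSlope
  rw [div_le_one (by positivity)]
  linarith [Real.exp_pos t]

lemma antitone_logisticSlope : Antitone logisticSlope := by
  intro t u h
  unfold logisticSlope
  gcongr

lemma monotone_add_logisticSlope : Monotone fun t => t + logisticSlope t := by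
  intro t u h
  have h1 : Real.exp u - Real.exp t ≤ Real.exp u * (u - t) := by
    have h2 := Real.add_one_le_exp (t - u)
    have h3 : Real.exp t = Real.exp u * Real.exp (t - u) := by rw [← Real.exp_add]; ring_nf
    rw [h3]
    nlinarith [Real.exp_pos u]
  have h4 : logisticSlope t - logisticSlope u
      = (Real.exp u - Real.exp t) / ((1 + Real.exp t) * (1 + Real.exp u)) := by
    unfold logisticSlope; field_simp; ring
  have h5 : (Real.exp u - Real.exp t) / ((1 + Real.exp t) * (1 + Real.exp u)) ≤ u - t := by
    rw [div_le_iff₀ (by positivity)]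
    refine h1.trans ?_
    rw [mul_comm]
    refine mul_le_mul_of_nonneg_left ?_ (by linarith)
    nlinarith [Real.exp_pos u, Real.exp_pos t, mul_pos (Real.exp_pos u) (Real.exp_pos t)]
  show t + logisticSlope t ≤ u + logisticSlope u
  linarith

lemma logisticLoss_tangent_le (t u : ℝ) :
    logisticLoss t - logisticSlope t * (u - t) ≤ logisticLoss u := by
  have := le_of_hasDerivAt_of_monotone hasDerivAt_logisticLoss
    (fun _ _ h => neg_le_neg (antitone_logisticSlope h)) t u
  linarith

/-- The logistic loss is `1`-smooth: `x ^ 2 / 2 - logisticLoss x` has monotone derivative and so lies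
above its tangents. -/
lemma logisticLoss_le_quadratic (t u : ℝ) :
    logisticLoss u ≤ logisticLoss t - logisticSlope t * (u - t) + (u - t) ^ 2 / 2 := by
  have hd (x : ℝ) : HasDerivAt (fun x => x ^ 2 / 2 - logisticLoss x) (x + logisticSlope x) x := by
    refine (((hasDerivAt_pow 2 x).div_const 2).sub (hasDerivAt_logisticLoss x)).congr_deriv ?_
    simp
  have := le_of_hasDerivAt_of_monotone hd monotone_add_logisticSlope t u
  nlinarith

lemma logisticLoss_pos (t : ℝ) : 0 < logisticLoss t :=
  Real.log_pos (by linarith [Real.exp_pos (-t)])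

lemma logisticLoss_le_exp_neg (t : ℝ) : logisticLoss t ≤ Real.exp (-t) := by
  have := Real.log_le_sub_one_of_pos (show 0 < 1 + Real.exp (-t) by positivity)
  unfold logisticLoss; linarith

lemma logisticSlope_le_logisticLoss (t : ℝ) : logisticSlope t ≤ logisticLoss t := by
  have h := Real.one_sub_inv_le_log_of_pos (show 0 < 1 + Real.exp (-t) by positivity)
  have h2 : logisticSlope t = 1 - (1 + Real.exp (-t))⁻¹ := by
    rw [logisticSlope, Real.exp_neg]; field_simp; ring
  rw [h2]; exact h

lemma one_fourth_le_logisticLoss {t : ℝ} (ht : t ≤ 1) : 1 / 4 ≤ logisticLoss t := by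
  refine le_trans ?_ (logisticSlope_le_logisticLoss t)
  unfold logisticSlope
  have : Real.exp t ≤ Real.exp 1 := Real.exp_le_exp.2 ht
  have := Real.exp_one_lt_d9
  gcongr
  linarith

/-! ### Gradient descent on the logistic risk -/

section Descent

variable {d m : ℕ}

/-- The gradient of the logistic empirical risk. -/
noncomputable def logisticGradient (S : Fin m → EuclideanSpace ℝ (Fin d) × ℝ)
    (w : EuclideanSpace ℝ (Fin d)) : EuclideanSpace ℝ (Fin d) :=
  -((1 / (m : ℝ)) • ∑ i, logisticSlope ((S i).2 * inner ℝ (S i).1 w) • (S i).2 • (S i).1)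

lemma inner_logisticGradient (S : Fin m → EuclideanSpace ℝ (Fin d) × ℝ)
    (w u : EuclideanSpace ℝ (Fin d)) :
    inner ℝ (logisticGradient S w) u = (1 / (m : ℝ)) *
      ∑ i, -(logisticSlope ((S i).2 * inner ℝ (S i).1 w) * ((S i).2 * inner ℝ (S i).1 u)) := by
  simp only [logisticGradient, inner_neg_left, real_inner_smul_left, sum_inner,
    Finset.sum_neg_distrib]
  ring

lemma gradient_logisticEmpiricalRisk (S : Fin m → EuclideanSpace ℝ (Fin d) × ℝ)
    (w : EuclideanSpace ℝ (Fin d)) :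
    gradient (logisticEmpiricalRisk S) w = logisticGradient S w := by
  refine HasGradientAt.gradient ?_
  rw [hasGradientAt_iff_hasFDerivAt]
  have h1 (i : Fin m) : HasFDerivAt (fun w => logisticLoss ((S i).2 * inner ℝ (S i).1 w))
      (-logisticSlope ((S i).2 * inner ℝ (S i).1 w) • ((S i).2 • innerSL ℝ (S i).1)) w :=
    (hasDerivAt_logisticLoss _).comp_hasFDerivAt w
      (((innerSL ℝ (S i).1).hasFDerivAt).const_mul (S i).2)
  have h2 := (HasFDerivAt.fun_sum fun i (_ : i ∈ Finset.univ) => h1 i).const_mul (1 / (m : ℝ))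
  refine h2.congr_fderiv ?_
  ext u
  rw [InnerProductSpace.toDual_apply_apply, inner_logisticGradient]
  simp

lemma logisticEmpiricalRisk_nonneg (S : Fin m → EuclideanSpace ℝ (Fin d) × ℝ)
    (w : EuclideanSpace ℝ (Fin d)) : 0 ≤ logisticEmpiricalRisk S w :=
  mul_nonneg (by positivity) (Finset.sum_nonneg fun _ _ => (logisticLoss_pos _).le)

lemma logisticEmpiricalRisk_tangent_le (S : Fin m → EuclideanSpace ℝ (Fin d) × ℝ)
    (w u : EuclideanSpace ℝ (Fin d)) :
    logisticEmpiricalRisk S w + inner ℝ (logisticGradient S w) (u - w) ≤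
      logisticEmpiricalRisk S u := by
  rw [inner_logisticGradient]
  unfold logisticEmpiricalRisk
  rw [← mul_add, ← Finset.sum_add_distrib]
  gcongr with i
  rw [inner_sub_right]
  linarith [logisticLoss_tangent_le ((S i).2 * inner ℝ (S i).1 w) ((S i).2 * inner ℝ (S i).1 u)]

variable {S : Fin m → EuclideanSpace ℝ (Fin d) × ℝ}

lemma logisticEmpiricalRisk_le_quadratic (hS : ∀ i, ‖(S i).2 • (S i).1‖ ≤ 1)
    (w u : EuclideanSpace ℝ (Fin d)) :
    logisticEmpiricalRisk S u ≤ logisticEmpiricalRisk S w +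
      inner ℝ (logisticGradient S w) (u - w) + ‖u - w‖ ^ 2 / 2 := by
  have hq : (1 / (m : ℝ)) * ∑ _i : Fin m, ‖u - w‖ ^ 2 / 2 ≤ ‖u - w‖ ^ 2 / 2 := by
    rw [Finset.sum_const, Finset.card_univ, Fintype.card_fin, nsmul_eq_mul, ← mul_assoc, one_div]
    exact mul_le_of_le_one_left (by positivity) (inv_mul_le_one)
  refine le_trans ?_ (add_le_add_right hq _)
  rw [inner_logisticGradient]
  unfold logisticEmpiricalRisk
  rw [← mul_add, ← mul_add, ← Finset.sum_add_distrib, ← Finset.sum_add_distrib]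
  gcongr with i
  have h1 := logisticLoss_le_quadratic ((S i).2 * inner ℝ (S i).1 w) ((S i).2 * inner ℝ (S i).1 u)
  have h2 : ((S i).2 * inner ℝ (S i).1 u - (S i).2 * inner ℝ (S i).1 w) ^ 2 ≤ ‖u - w‖ ^ 2 := by
    rw [← mul_sub, ← inner_sub_right, ← real_inner_smul_left, sq_le_sq, abs_norm]
    refine (abs_real_inner_le_norm _ _).trans ?_
    exact mul_le_of_le_one_left (norm_nonneg _) (hS i)
  rw [inner_sub_right]
  linarith

/-- Self-bounding property: the slope of the loss is at most `1` and at most the loss itself. -/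
lemma norm_sq_logisticGradient_le (hS : ∀ i, ‖(S i).2 • (S i).1‖ ≤ 1)
    (w : EuclideanSpace ℝ (Fin d)) :
    ‖logisticGradient S w‖ ^ 2 ≤ logisticEmpiricalRisk S w := by
  have h0 : ‖logisticGradient S w‖ ≤
      (1 / (m : ℝ)) * ∑ i, logisticSlope ((S i).2 * inner ℝ (S i).1 w) := by
    rw [logisticGradient, norm_neg, norm_smul, Real.norm_of_nonneg (by positivity)]
    gcongr
    refine (norm_sum_le _ _).trans ?_
    gcongr with i
    rw [norm_smul, Real.norm_of_nonneg (logisticSlope_pos _).le]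
    exact mul_le_of_le_one_right (logisticSlope_pos _).le (hS i)
  have h1 : ‖logisticGradient S w‖ ≤ 1 := by
    refine h0.trans ?_
    calc (1 / (m : ℝ)) * ∑ i, logisticSlope ((S i).2 * inner ℝ (S i).1 w)
        ≤ (1 / (m : ℝ)) * ∑ _i : Fin m, 1 := by
          gcongr with i
          exact logisticSlope_le_one _
      _ ≤ 1 := by simpa using inv_mul_le_one
  have h2 : ‖logisticGradient S w‖ ≤ logisticEmpiricalRisk S w := by
    refine h0.trans ?_
    unfold logisticEmpiricalRisk
    gcongr with i
    exact logisticSlope_le_logisticLoss _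
  nlinarith [norm_nonneg (logisticGradient S w)]

lemma logisticEmpiricalRisk_step_le (hS : ∀ i, ‖(S i).2 • (S i).1‖ ≤ 1)
    (w : EuclideanSpace ℝ (Fin d)) :
    logisticEmpiricalRisk S (w - logisticGradient S w) ≤ logisticEmpiricalRisk S w := by
  have h := logisticEmpiricalRisk_le_quadratic hS w (w - logisticGradient S w)
  rw [sub_sub_cancel_left, inner_neg_right, real_inner_self_eq_norm_sq, norm_neg] at h
  nlinarith [sq_nonneg ‖logisticGradient S w‖]

lemma norm_sq_step_sub_le (hS : ∀ i, ‖(S i).2 • (S i).1‖ ≤ 1)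
    (w u : EuclideanSpace ℝ (Fin d)) :
    ‖w - logisticGradient S w - u‖ ^ 2 + logisticEmpiricalRisk S w ≤
      ‖w - u‖ ^ 2 + 2 * logisticEmpiricalRisk S u := by
  have h1 : w - logisticGradient S w - u = (w - u) - logisticGradient S w := by abel
  have h2 := logisticEmpiricalRisk_tangent_le S w u
  have h3 := norm_sq_logisticGradient_le hS w
  rw [← neg_sub w u, inner_neg_right, real_inner_comm] at h2
  rw [h1, norm_sub_sq_real]
  linarith

lemma gradientDescent_succ (S : Fin m → EuclideanSpace ℝ (Fin d) × ℝ) (T : ℕ) :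
    gradientDescent (logisticEmpiricalRisk S) (fun _ => 1) 0 (T + 1) =
      gradientDescent (logisticEmpiricalRisk S) (fun _ => 1) 0 T -
        logisticGradient S (gradientDescent (logisticEmpiricalRisk S) (fun _ => 1) 0 T) := by
  rw [gradientDescent, one_smul, gradient_logisticEmpiricalRisk]

/-- Regret bound of gradient descent against an arbitrary comparator `u`, with the sum of the risks
along the trajectory bounded below by `T` times the risk of the last iterate. -/
lemma gradientDescent_regret (hS : ∀ i, ‖(S i).2 • (S i).1‖ ≤ 1)
    (u : EuclideanSpace ℝ (Fin d)) (T : ℕ) :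
    ‖gradientDescent (logisticEmpiricalRisk S) (fun _ => 1) 0 T - u‖ ^ 2 +
        T * logisticEmpiricalRisk S (gradientDescent (logisticEmpiricalRisk S) (fun _ => 1) 0 T) ≤
      ‖u‖ ^ 2 + 2 * T * logisticEmpiricalRisk S u := by
  induction T with
  | zero => simp [gradientDescent]
  | succ T ih =>
    rw [gradientDescent_succ]
    set w := gradientDescent (logisticEmpiricalRisk S) (fun _ => 1) 0 T
    have h1 := norm_sq_step_sub_le hS w u
    have h2 := logisticEmpiricalRisk_step_le hS w
    have h3 : ((T : ℝ) + 1) * logisticEmpiricalRisk S (w - logisticGradient S w) ≤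
        ((T : ℝ) + 1) * logisticEmpiricalRisk S w := by gcongr
    push_cast
    linarith

lemma logisticEmpiricalRisk_smul_le {γ c : ℝ} (hc : 0 ≤ c) (w₀ : EuclideanSpace ℝ (Fin d))
    (hS : ∀ i, γ ≤ (S i).2 * inner ℝ (S i).1 w₀) :
    logisticEmpiricalRisk S (c • w₀) ≤ Real.exp (-(c * γ)) := by
  calc logisticEmpiricalRisk S (c • w₀)
      ≤ (1 / (m : ℝ)) * ∑ _i : Fin m, Real.exp (-(c * γ)) := by
        unfold logisticEmpiricalRisk
        gcongr with i
        refine (logisticLoss_le_exp_neg _).trans (Real.exp_le_exp.2 (neg_le_neg ?_))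
        rw [real_inner_smul_right]
        nlinarith [hS i]
    _ ≤ Real.exp (-(c * γ)) := by
        rw [Finset.sum_const, Finset.card_univ, Fintype.card_fin, nsmul_eq_mul, ← mul_assoc,
          one_div]
        exact mul_le_of_le_one_left (Real.exp_pos _).le inv_mul_le_one

/-- On `γ`-separable data, the `T`-th iterate has risk `Õ(1 / (γ² T))` and norm `Õ(1 / γ)`. -/
lemma gradientDescent_separable {γ : ℝ} {w₀ : EuclideanSpace ℝ (Fin d)} (hw₀ : ‖w₀‖ = 1)
    (hγ : 0 < γ) (hγ1 : γ ≤ 1) (hS : ∀ i, ‖(S i).2 • (S i).1‖ ≤ 1)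
    (hsep : ∀ i, γ ≤ (S i).2 * inner ℝ (S i).1 w₀) {T : ℕ} (hT : 1 ≤ T) :
    logisticEmpiricalRisk S (gradientDescent (logisticEmpiricalRisk S) (fun _ => 1) 0 T) ≤
        3 * Real.log (Real.exp 1 + T) ^ 2 * (1 / (γ ^ 2 * T)) ∧
      ‖gradientDescent (logisticEmpiricalRisk S) (fun _ => 1) 0 T‖ ^ 2 ≤
        8 * Real.log (Real.exp 1 + T) ^ 2 / γ ^ 2 := by
  have hT0 : (0 : ℝ) < T := by exact_mod_cast hT
  set B := Real.log (Real.exp 1 + T) with hB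
  have hB1 : 1 ≤ B := by
    rw [hB, Real.le_log_iff_exp_le (by positivity)]
    linarith
  -- The comparator is scaled so that its risk is at most `1 / T`.
  have hu := logisticEmpiricalRisk_smul_le (c := B / γ) (by positivity) w₀ hsep
  rw [div_mul_cancel₀ _ hγ.ne', Real.exp_neg, hB, Real.exp_log (by positivity), ← hB] at hu
  have hreg := gradientDescent_regret hS ((B / γ) • w₀) T
  have hun : ‖(B / γ) • w₀‖ = B / γ := by
    rw [norm_smul, hw₀, mul_one, Real.norm_of_nonneg (by positivity)]
  have hTu : T * logisticEmpiricalRisk S ((B / γ) • w₀) ≤ 1 := by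
    calc T * logisticEmpiricalRisk S ((B / γ) • w₀) ≤ T * (Real.exp 1 + T)⁻¹ := by gcongr
      _ ≤ 1 := by
        rw [← div_eq_mul_inv, div_le_one (by positivity)]
        linarith [Real.exp_pos 1]
  set w := gradientDescent (logisticEmpiricalRisk S) (fun _ => 1) 0 T
  have hBγ : 1 ≤ B / γ := by rw [le_div_iff₀ hγ]; linarith
  have hrhs : ‖w - (B / γ) • w₀‖ ^ 2 + T * logisticEmpiricalRisk S w ≤ 3 * (B / γ) ^ 2 := by
    rw [hun] at hreg
    nlinarith
  have hL := logisticEmpiricalRisk_nonneg S w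
  constructor
  · have : 3 * B ^ 2 * (1 / (γ ^ 2 * T)) = 3 * (B / γ) ^ 2 / T := by field_simp
    rw [this, le_div_iff₀ hT0]
    nlinarith [sq_nonneg ‖w - (B / γ) • w₀‖]
  · have h1 : ‖w‖ ≤ ‖w - (B / γ) • w₀‖ + B / γ := by
      have h := norm_add_le (w - (B / γ) • w₀) ((B / γ) • w₀)
      rwa [sub_add_cancel, hun] at h
    have h2 : ‖w - (B / γ) • w₀‖ ^ 2 ≤ 3 * (B / γ) ^ 2 := by nlinarith
    have h3 : 8 * B ^ 2 / γ ^ 2 = 8 * (B / γ) ^ 2 := by field_simp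
    rw [h3]
    calc ‖w‖ ^ 2 ≤ (‖w - (B / γ) • w₀‖ + B / γ) ^ 2 := by gcongr
      _ ≤ 2 * (‖w - (B / γ) • w₀‖ ^ 2 + (B / γ) ^ 2) := by
        linarith [sq_nonneg (‖w - (B / γ) • w₀‖ - B / γ)]
      _ ≤ 8 * (B / γ) ^ 2 := by linarith

end Descent

/-! ### The standard Gaussian prior -/

lemma exp_neg_norm_add_sq {E : Type*} [NormedAddCommGroup E] [InnerProductSpace ℝ E] (v w : E) :
    Real.exp (-‖v + w‖ ^ 2 / 2) =
      Real.exp (-‖v‖ ^ 2 / 2) * Real.exp (-inner ℝ w v - ‖w‖ ^ 2 / 2) := by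
  rw [← Real.exp_add, norm_add_sq_real, real_inner_comm]
  ring_nf

section Gaussian

variable (E : Type*) [NormedAddCommGroup E] [InnerProductSpace ℝ E] [FiniteDimensional ℝ E]
  [MeasurableSpace E] [BorelSpace E]

/-- The standard Gaussian measure on a Euclidean space, given by its density, proportional to
`exp (-‖v‖² / 2)`, with respect to Lebesgue measure. -/
noncomputable def gaussianPrior : Measure E :=
  (volume : Measure E).tilted fun v => -‖v‖ ^ 2 / 2

lemma integrable_exp_neg_norm_sq_div_two :
    Integrable (fun v : E => Real.exp (-‖v‖ ^ 2 / 2)) volume := by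
  have h := GaussianFourier.integral_rexp_neg_mul_sq_norm (V := E) (b := 1 / 2) (by norm_num)
  have h1 : (fun v : E => Real.exp (-‖v‖ ^ 2 / 2)) = fun v => Real.exp (-(1 / 2) * ‖v‖ ^ 2) := by
    ext v; ring_nf
  rw [h1]
  by_contra hn
  rw [integral_undef hn] at h
  exact (show (0 : ℝ) < (Real.pi / (1 / 2)) ^ (Module.finrank ℝ E / 2 : ℝ) by positivity).ne h

instance : IsProbabilityMeasure (gaussianPrior E) :=
  isProbabilityMeasure_tilted (integrable_exp_neg_norm_sq_div_two E)

variable {E}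

/-- Cameron–Martin formula for the standard Gaussian measure. -/
lemma integral_gaussianPrior_shift (w : E) (h : E → ℝ) :
    ∫ v, h v ∂gaussianPrior E =
      ∫ v, h (v + w) * Real.exp (-inner ℝ w v - ‖w‖ ^ 2 / 2) ∂gaussianPrior E := by
  rw [gaussianPrior, integral_tilted, integral_tilted, ← integral_add_right_eq_self _ w]
  congr 1
  ext v
  rw [exp_neg_norm_add_sq]
  simp only [smul_eq_mul]
  ring

lemma integrable_gaussianPrior_exp (w : E) :
    Integrable (fun v => Real.exp (-inner ℝ w v - ‖w‖ ^ 2 / 2)) (gaussianPrior E) := by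
  rw [gaussianPrior, integrable_tilted_iff (integrable_exp_neg_norm_sq_div_two E)]
  convert (integrable_exp_neg_norm_sq_div_two E).comp_add_right w using 2 with v
  rw [exp_neg_norm_add_sq, smul_eq_mul]

lemma integral_gaussianPrior_exp (w : E) :
    ∫ v, Real.exp (-inner ℝ w v - ‖w‖ ^ 2 / 2) ∂gaussianPrior E = 1 := by
  simpa using (integral_gaussianPrior_shift w fun _ => 1).symm

lemma measurePreserving_neg_gaussianPrior :
    MeasurePreserving (fun v : E => -v) (gaussianPrior E) (gaussianPrior E) := by
  refine ⟨measurable_neg, Measure.ext_of_lintegral _ fun f hf => ?_⟩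
  rw [lintegral_map hf measurable_neg, gaussianPrior, lintegral_tilted, lintegral_tilted,
    ← lintegral_neg_eq_self]
  simp

lemma integrable_inner_gaussianPrior (w : E) :
    Integrable (fun v => inner ℝ w v) (gaussianPrior E) := by
  have h1 := integrable_gaussianPrior_exp w
  have h2 := integrable_gaussianPrior_exp (-w)
  refine ((h1.add h2).mul_const (Real.exp (‖w‖ ^ 2 / 2))).mono'
    (by fun_prop) (ae_of_all _ fun v => ?_)
  simp only [Pi.add_apply, inner_neg_left, norm_neg, neg_neg]
  rw [add_mul, ← Real.exp_add, ← Real.exp_add, sub_add_cancel, sub_add_cancel, Real.norm_eq_abs]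
  rcases abs_cases (inner ℝ w v) with h | h <;>
    linarith [Real.add_one_le_exp (inner ℝ w v), Real.add_one_le_exp (-inner ℝ w v),
      Real.exp_pos (inner ℝ w v), Real.exp_pos (-inner ℝ w v)]

lemma integral_inner_gaussianPrior (w : E) : ∫ v, inner ℝ w v ∂gaussianPrior E = 0 := by
  have h := (measurePreserving_neg_gaussianPrior (E := E)).integral_comp
    (MeasurableEquiv.neg E).measurableEmbedding (fun v => inner ℝ w v)
  simp only [inner_neg_right, integral_neg] at h
  linarith

/-- Change of measure from the prior to its translate by `w`, whose relative entropy with respect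
to the prior is `‖w‖² / 2`. -/
lemma exp_integral_shift_le {F : E → ℝ} (hF : Measurable F) {M : ℝ} (hM : ∀ v, |F v| ≤ M)
    (w : E) :
    Real.exp (∫ v, F (v + w) ∂gaussianPrior E - ‖w‖ ^ 2 / 2) ≤
      ∫ v, Real.exp (F v) ∂gaussianPrior E := by
  rw [integral_gaussianPrior_shift w fun v => Real.exp (F v)]
  have hFi : Integrable (fun v => F (v + w)) (gaussianPrior E) :=
    Integrable.of_bound (hF.comp (measurable_add_const w)).aestronglyMeasurable M
      (ae_of_all _ fun v => hM _)
  have hLi : Integrable (fun v => -inner ℝ w v - ‖w‖ ^ 2 / 2) (gaussianPrior E) :=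
    (integrable_inner_gaussianPrior w).neg.sub (integrable_const _)
  have hI : ∫ v, (F (v + w) + (-inner ℝ w v - ‖w‖ ^ 2 / 2)) ∂gaussianPrior E =
      ∫ v, F (v + w) ∂gaussianPrior E - ‖w‖ ^ 2 / 2 := by
    have h : ∫ v, (-inner ℝ w v - ‖w‖ ^ 2 / 2) ∂gaussianPrior E = -(‖w‖ ^ 2 / 2) := by
      refine (integral_sub (integrable_inner_gaussianPrior w).neg (integrable_const _)).trans ?_
      simp [integral_neg, integral_inner_gaussianPrior]
    rw [integral_add hFi hLi, h, sub_eq_add_neg]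
  rw [← hI]
  simp_rw [← Real.exp_add]
  refine convexOn_exp.map_integral_le Real.continuous_exp.continuousOn isClosed_univ
    (ae_of_all _ fun _ => Set.mem_univ _) (hFi.add hLi) ?_
  refine ((integrable_gaussianPrior_exp w).const_mul (Real.exp M)).mono' (by measurability)
    (ae_of_all _ fun v => ?_)
  simp only [Function.comp_apply]
  rw [Real.norm_of_nonneg (Real.exp_pos _).le, Real.exp_add]
  gcongr
  exact (le_abs_self _).trans (hM _)

lemma measurableSet_inner_le (x : E) (c : ℝ) : MeasurableSet {v : E | inner ℝ x v ≤ c} :=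
  measurableSet_le (by fun_prop) measurable_const

lemma half_le_gaussianPrior_halfspace (x : E) {c : ℝ} (hc : 0 ≤ c) :
    1 / 2 ≤ (gaussianPrior E).real {v | inner ℝ x v ≤ c} := by
  have h1 : (gaussianPrior E).real {v | 0 ≤ inner ℝ x v} =
      (gaussianPrior E).real {v | inner ℝ x v ≤ 0} := by
    rw [← (measurePreserving_neg_gaussianPrior (E := E)).measureReal_preimage
      (measurableSet_inner_le x 0).nullMeasurableSet]
    simp
  have h2 : (gaussianPrior E).real Set.univ ≤ (gaussianPrior E).real {v | inner ℝ x v ≤ 0} +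
      (gaussianPrior E).real {v | 0 ≤ inner ℝ x v} := by
    refine le_trans (measureReal_mono fun v _ => ?_) (measureReal_union_le _ _)
    exact le_total (inner ℝ x v) 0
  rw [probReal_univ, h1] at h2
  have h3 : (gaussianPrior E).real {v | inner ℝ x v ≤ 0} ≤
      (gaussianPrior E).real {v | inner ℝ x v ≤ c} :=
    measureReal_mono fun v (hv : inner ℝ x v ≤ 0) => hv.trans hc
  linarith

/-- Gaussian tail bound for half-spaces, by Markov's inequality for the exponential moment. -/
lemma gaussianPrior_halfspace_le {x : E} (hx : ‖x‖ ≤ 1) {c : ℝ} (hc : 0 ≤ c) :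
    (gaussianPrior E).real {v | inner ℝ x v ≤ -c} ≤ Real.exp (-c ^ 2 / 2) := by
  have hi := integrable_gaussianPrior_exp (c • x)
  have h := mul_meas_ge_le_integral_of_nonneg (ae_of_all _ fun v => (Real.exp_pos _).le) hi
    (Real.exp (c ^ 2 / 2))
  rw [integral_gaussianPrior_exp] at h
  have hsub : {v | inner ℝ x v ≤ -c} ⊆
      {v : E | Real.exp (c ^ 2 / 2) ≤ Real.exp (-inner ℝ (c • x) v - ‖c • x‖ ^ 2 / 2)} := by
    intro v (hv : inner ℝ x v ≤ -c)
    refine Real.exp_le_exp.2 ?_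
    rw [real_inner_smul_left, norm_smul, Real.norm_of_nonneg hc]
    have h1 : (c * ‖x‖) ^ 2 ≤ c ^ 2 := by
      gcongr
      exact mul_le_of_le_one_right hc hx
    nlinarith
  have h2 := measureReal_mono hsub (μ := gaussianPrior E)
  rw [neg_div, Real.exp_neg, ← one_div, le_div_iff₀ (Real.exp_pos _)]
  nlinarith [Real.exp_pos (c ^ 2 / 2)]

end Gaussian

/-! ### A PAC-Bayes exponential moment -/

section PACBayes

lemma exp_neg_le_one_sub {x : ℝ} (h0 : 0 ≤ x) (h1 : x ≤ 1) :
    Real.exp (-x) ≤ 1 - (1 - Real.exp (-1)) * x := by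
  have h := convexOn_exp.2 (Set.mem_univ 0) (Set.mem_univ (-1)) (sub_nonneg.2 h1) h0 (by ring)
  simp only [smul_eq_mul, mul_zero, zero_add, Real.exp_zero, mul_neg, mul_one] at h
  linarith

lemma exp_neg_one_le_half : Real.exp (-1) ≤ 1 / 2 := by
  rw [Real.exp_neg, ← one_div]
  have := Real.add_one_le_exp (1 : ℝ)
  gcongr
  linarith

lemma integral_exp_neg_le {Z : Type*} [MeasurableSpace Z] (D : Measure Z) [IsProbabilityMeasure D]
    {X : Z → ℝ} (hX : Measurable X) (h0 : ∀ z, 0 ≤ X z) (h1 : ∀ z, X z ≤ 1) :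
    ∫ z, Real.exp (-X z) ∂D ≤ Real.exp (-((1 - Real.exp (-1)) * ∫ z, X z ∂D)) := by
  have hXi : Integrable X D := Integrable.of_bound hX.aestronglyMeasurable 1
    (ae_of_all _ fun z => by rw [Real.norm_of_nonneg (h0 z)]; exact h1 z)
  have hei : Integrable (fun z => Real.exp (-X z)) D :=
    Integrable.of_bound hX.neg.exp.aestronglyMeasurable 1
      (ae_of_all _ fun z => by
        rw [Real.norm_of_nonneg (Real.exp_pos _).le, Real.exp_le_one_iff]
        linarith [h0 z])
  calc ∫ z, Real.exp (-X z) ∂D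
      ≤ ∫ z, (1 - (1 - Real.exp (-1)) * X z) ∂D :=
        integral_mono hei ((integrable_const _).sub (hXi.const_mul _))
          fun z => exp_neg_le_one_sub (h0 z) (h1 z)
    _ = 1 - (1 - Real.exp (-1)) * ∫ z, X z ∂D := by
        rw [integral_sub (integrable_const _) (hXi.const_mul _), integral_const_mul]
        simp
    _ ≤ _ := by
        have := Real.add_one_le_exp (-((1 - Real.exp (-1)) * ∫ z, X z ∂D))
        linarith

variable {Z V : Type*} [MeasurableSpace Z]

/-- The exponent `(1 - e⁻¹) m 𝔼ℓ(z, v) - ∑ᵢ ℓ(Sᵢ, v)` comparing the population and the empirical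
risk of the predictor `v` for the loss `ℓ`. -/
noncomputable def riskGap {m : ℕ} (D : Measure Z) (l : Z → V → ℝ) (S : Fin m → Z) (v : V) : ℝ :=
  (1 - Real.exp (-1)) * (m * ∫ z, l z v ∂D) - ∑ i, l (S i) v

variable (D : Measure Z) [IsProbabilityMeasure D] {l : Z → V → ℝ}

lemma measurable_riskGap [MeasurableSpace V] (hl : Measurable (Function.uncurry l)) (m : ℕ) :
    Measurable fun p : (Fin m → Z) × V => riskGap D l p.1 p.2 := by
  have h1 : Measurable fun v => ∫ z, l z v ∂D :=
    (hl.stronglyMeasurable.integral_prod_left).measurable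
  have h2 (i : Fin m) : Measurable fun p : (Fin m → Z) × V => l (p.1 i) p.2 :=
    hl.comp (f := fun p : (Fin m → Z) × V => (p.1 i, p.2))
      (((measurable_pi_apply i).comp measurable_fst).prodMk measurable_snd)
  exact (((h1.comp measurable_snd).const_mul _).const_mul _).sub
    (Finset.measurable_sum _ fun i _ => h2 i)

lemma measurable_riskGap_right [MeasurableSpace V] (hl : Measurable (Function.uncurry l)) {m : ℕ}
    (S : Fin m → Z) : Measurable (riskGap D l S) :=
  (measurable_riskGap D hl m).comp measurable_prodMk_left

lemma abs_riskGap_le (h0 : ∀ z v, 0 ≤ l z v) (h1 : ∀ z v, l z v ≤ 1) {m : ℕ} (S : Fin m → Z)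
    (v : V) : |riskGap D l S v| ≤ m := by
  have hI0 : 0 ≤ ∫ z, l z v ∂D := integral_nonneg fun z => h0 z v
  have hI1 : ∫ z, l z v ∂D ≤ 1 := by
    have := integral_mono_of_nonneg (ae_of_all D fun z => h0 z v) (integrable_const (1 : ℝ))
      (ae_of_all D fun z => h1 z v)
    simpa using this
  have hs0 : 0 ≤ ∑ i, l (S i) v := Finset.sum_nonneg fun i _ => h0 _ _
  have hs1 : ∑ i, l (S i) v ≤ m := by
    simpa using Finset.sum_le_sum fun i (_ : i ∈ Finset.univ) => h1 (S i) v
  have he := Real.exp_pos (-1)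
  have he1 := exp_neg_one_le_half
  have hm : (m : ℝ) * ∫ z, l z v ∂D ≤ m := mul_le_of_le_one_right (by positivity) hI1
  have hm0 : 0 ≤ (m : ℝ) * ∫ z, l z v ∂D := by positivity
  rw [riskGap, abs_le]
  constructor <;> nlinarith

variable [MeasurableSpace V] (P : Measure V) [IsProbabilityMeasure P]

/-- Over the draw of the sample, the exponential moment of the risk gap is at most `1` for each
fixed predictor, hence also on average over the prior `P`. -/
lemma integral_exp_riskGap_le_one (hl : Measurable (Function.uncurry l)) (h0 : ∀ z v, 0 ≤ l z v)
    (h1 : ∀ z v, l z v ≤ 1) (m : ℕ) :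
    ∫ S, ∫ v, Real.exp (riskGap D l S v) ∂P ∂(Measure.pi fun _ : Fin m => D) ≤ 1 := by
  have hint : Integrable (Function.uncurry fun (S : Fin m → Z) v => Real.exp (riskGap D l S v))
      ((Measure.pi fun _ : Fin m => D).prod P) :=
    Integrable.of_bound (measurable_riskGap D hl m).exp.aestronglyMeasurable (Real.exp m)
      (ae_of_all _ fun p => by
        simp only [Function.uncurry]
        rw [Real.norm_of_nonneg (Real.exp_pos _).le, Real.exp_le_exp]
        exact (le_abs_self _).trans (abs_riskGap_le D h0 h1 _ _))
  rw [integral_integral_swap hint]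
  have hv (v : V) : ∫ S, Real.exp (riskGap D l S v) ∂(Measure.pi fun _ : Fin m => D) ≤ 1 := by
    have hlv : Measurable fun z => l z v := hl.comp measurable_prodMk_right
    have h2 := integral_exp_neg_le D hlv (h0 · v) (h1 · v)
    have h3 (S : Fin m → Z) : Real.exp (riskGap D l S v) =
        Real.exp ((1 - Real.exp (-1)) * (m * ∫ z, l z v ∂D)) * ∏ i, Real.exp (-l (S i) v) := by
      rw [← Real.exp_sum, ← Real.exp_add, Finset.sum_neg_distrib, ← sub_eq_add_neg, riskGap]
    simp_rw [h3]
    rw [integral_const_mul, integral_fintype_prod_eq_pow fun z => Real.exp (-l z v),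
      Fintype.card_fin]
    calc _ ≤ Real.exp ((1 - Real.exp (-1)) * (m * ∫ z, l z v ∂D)) *
          Real.exp (-((1 - Real.exp (-1)) * ∫ z, l z v ∂D)) ^ m := by
          gcongr
      _ = 1 := by
          rw [← Real.exp_nat_mul, ← Real.exp_add, Real.exp_eq_one_iff]
          ring
  have := integral_mono_of_nonneg (ae_of_all P fun v => integral_nonneg
    fun S => (Real.exp_pos (riskGap D l S v)).le) (integrable_const (1 : ℝ)) (ae_of_all P hv)
  simpa using this

lemma measureReal_exp_riskGap_ge_le (hl : Measurable (Function.uncurry l))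
    (h0 : ∀ z v, 0 ≤ l z v) (h1 : ∀ z v, l z v ≤ 1) (m : ℕ) {δ : ℝ} (hδ : 0 < δ) :
    (Measure.pi fun _ : Fin m => D).real {S | 1 / δ ≤ ∫ v, Real.exp (riskGap D l S v) ∂P} ≤ δ := by
  have hle (S : Fin m → Z) (v : V) : ‖Real.exp (riskGap D l S v)‖ ≤ Real.exp m := by
    rw [Real.norm_of_nonneg (Real.exp_pos _).le, Real.exp_le_exp]
    exact (le_abs_self _).trans (abs_riskGap_le D h0 h1 _ _)
  have hint : Integrable (fun S : Fin m → Z => ∫ v, Real.exp (riskGap D l S v) ∂P)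
      (Measure.pi fun _ : Fin m => D) := by
    refine Integrable.of_bound
      ((measurable_riskGap D hl m).exp.stronglyMeasurable.integral_prod_right').aestronglyMeasurable
      (Real.exp m) (ae_of_all _ fun S => ?_)
    simpa using norm_integral_le_of_norm_le_const (μ := P) (ae_of_all _ (hle S))
  have h := mul_meas_ge_le_integral_of_nonneg (ae_of_all _ fun S => integral_nonneg
    fun v => (Real.exp_pos (riskGap D l S v)).le) hint (1 / δ)
  have h2 := h.trans (integral_exp_riskGap_le_one D P hl h0 h1 m)
  rwa [one_div, inv_mul_le_iff₀ hδ, mul_one, ← one_div] at h2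

end PACBayes

/-! ### Generalization of linear classifiers from their logistic risk -/

section MarginBound

variable {d m : ℕ}

/-- The 0-1 loss of the linear classifier `v` on the labelled point `z = (x, y)`, with `⟨x, v⟩ = 0`
counted as an error. -/
noncomputable def linearError (z : EuclideanSpace ℝ (Fin d) × ℝ) (v : EuclideanSpace ℝ (Fin d)) :
    ℝ :=
  Set.indicator {v | inner ℝ (z.2 • z.1) v ≤ 0} 1 v

lemma linearError_nonneg (z : EuclideanSpace ℝ (Fin d) × ℝ) (v : EuclideanSpace ℝ (Fin d)) :
    0 ≤ linearError z v :=
  Set.indicator_nonneg (fun _ _ => zero_le_one) v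

lemma linearError_le_one (z : EuclideanSpace ℝ (Fin d) × ℝ) (v : EuclideanSpace ℝ (Fin d)) :
    linearError z v ≤ 1 :=
  Set.indicator_le_self' (fun _ _ => zero_le_one) v

lemma measurable_linearError : Measurable (Function.uncurry (linearError (d := d))) := by
  have hs : MeasurableSet {p : (EuclideanSpace ℝ (Fin d) × ℝ) × EuclideanSpace ℝ (Fin d) |
      inner ℝ (p.1.2 • p.1.1) p.2 ≤ 0} :=
    measurableSet_le (by fun_prop) measurable_const
  exact measurable_one.indicator hs

lemma integrable_linearError {α : Type*} [MeasurableSpace α] (μ : Measure α) [IsFiniteMeasure μ]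
    {f : α → EuclideanSpace ℝ (Fin d) × ℝ} {g : α → EuclideanSpace ℝ (Fin d)}
    (hf : Measurable f) (hg : Measurable g) : Integrable (fun a => linearError (f a) (g a)) μ :=
  Integrable.of_bound (measurable_linearError.comp (hf.prodMk hg)).aestronglyMeasurable 1
    (ae_of_all _ fun a => by
      rw [Real.norm_of_nonneg (linearError_nonneg _ _)]
      exact linearError_le_one _ _)

lemma integral_linearError_shift (z : EuclideanSpace ℝ (Fin d) × ℝ)
    (u : EuclideanSpace ℝ (Fin d)) :
    ∫ v, linearError z (v + u) ∂gaussianPrior (EuclideanSpace ℝ (Fin d)) =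
      (gaussianPrior (EuclideanSpace ℝ (Fin d))).real
        {v | inner ℝ (z.2 • z.1) v ≤ -inner ℝ (z.2 • z.1) u} := by
  rw [← integral_indicator_one (measurableSet_inner_le _ _)]
  congr 1
  ext v
  simp only [linearError, Set.indicator, Set.mem_ofPred_eq, inner_add_right,
    ← le_neg_iff_add_nonpos_right, Pi.one_apply]

/-- A misclassified point stays misclassified by the Gaussian perturbation with probability at
least one half. -/
lemma linearError_le_two_mul_integral (z : EuclideanSpace ℝ (Fin d) × ℝ)
    (w : EuclideanSpace ℝ (Fin d)) {c : ℝ} (hc : 0 ≤ c) :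
    linearError z w ≤
      2 * ∫ v, linearError z (v + c • w) ∂gaussianPrior (EuclideanSpace ℝ (Fin d)) := by
  rw [integral_linearError_shift]
  by_cases h : inner ℝ (z.2 • z.1) w ≤ 0
  · have h1 := half_le_gaussianPrior_halfspace (z.2 • z.1)
      (c := -inner ℝ (z.2 • z.1) (c • w))
      (by rw [real_inner_smul_right]; nlinarith)
    linarith [linearError_le_one z w]
  · have h0 : linearError z w = 0 :=
      Set.indicator_of_notMem (s := {v | inner ℝ (z.2 • z.1) v ≤ 0}) h _
    rw [h0]
    positivity

/-- A point of margin at least `1` is misclassified by the Gaussian perturbation with exponentially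
small probability; on all other points the logistic loss is at least `1 / 4`. -/
lemma integral_linearError_le {z : EuclideanSpace ℝ (Fin d) × ℝ} (hz : ‖z.2 • z.1‖ ≤ 1)
    (w : EuclideanSpace ℝ (Fin d)) {c : ℝ} (hc : 0 ≤ c) :
    ∫ v, linearError z (v + c • w) ∂gaussianPrior (EuclideanSpace ℝ (Fin d)) ≤
      Real.exp (-c ^ 2 / 2) + 4 * logisticLoss (z.2 * inner ℝ z.1 w) := by
  rw [integral_linearError_shift, ← real_inner_smul_left]
  rcases le_total 1 (inner ℝ (z.2 • z.1) w) with h | h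
  · have h1 : (gaussianPrior (EuclideanSpace ℝ (Fin d))).real
        {v | inner ℝ (z.2 • z.1) v ≤ -inner ℝ (z.2 • z.1) (c • w)} ≤
        (gaussianPrior (EuclideanSpace ℝ (Fin d))).real {v | inner ℝ (z.2 • z.1) v ≤ -c} := by
      refine measureReal_mono fun v hv => ?_
      simp only [Set.mem_ofPred_eq, real_inner_smul_right] at hv ⊢
      nlinarith
    linarith [gaussianPrior_halfspace_le hz hc, logisticLoss_pos (inner ℝ (z.2 • z.1) w)]
  · linarith [one_fourth_le_logisticLoss h, Real.exp_pos (-c ^ 2 / 2),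
      measureReal_le_one (μ := gaussianPrior (EuclideanSpace ℝ (Fin d)))
        (s := {v | inner ℝ (z.2 • z.1) v ≤ -inner ℝ (z.2 • z.1) (c • w)})]

variable (D : Measure (EuclideanSpace ℝ (Fin d) × ℝ)) [IsProbabilityMeasure D]

lemma zeroOneError_le_integral_linearError (hD : ∀ᵐ z ∂D, z.2 = -1 ∨ z.2 = 1)
    (w : EuclideanSpace ℝ (Fin d)) : zeroOneError D w ≤ ∫ z, linearError z w ∂D := by
  have hs : MeasurableSet {z : EuclideanSpace ℝ (Fin d) × ℝ | inner ℝ (z.2 • z.1) w ≤ 0} :=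
    measurableSet_le (by fun_prop) measurable_const
  have h1 : ∫ z, linearError z w ∂D =
      D.real {z : EuclideanSpace ℝ (Fin d) × ℝ | inner ℝ (z.2 • z.1) w ≤ 0} := by
    rw [← integral_indicator_one hs]
    rfl
  rw [h1]
  refine ENNReal.toReal_mono (measure_ne_top _ _) (measure_mono_ae ?_)
  filter_upwards [hD] with z hz (hne : Real.sign (inner ℝ z.1 w) ≠ z.2)
  show inner ℝ (z.2 • z.1) w ≤ 0
  rw [real_inner_smul_left]
  by_contra! hpos
  rcases hz with hz | hz <;> rw [hz] at hne hpos
  · exact hne (Real.sign_of_neg (by linarith))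
  · exact hne (Real.sign_of_pos (by linarith))

lemma integrable_integral_linearError_shift (u : EuclideanSpace ℝ (Fin d)) :
    Integrable (fun v => ∫ z, linearError z (v + u) ∂D)
      (gaussianPrior (EuclideanSpace ℝ (Fin d))) :=
  (integrable_linearError ((gaussianPrior (EuclideanSpace ℝ (Fin d))).prod D)
    measurable_snd (measurable_fst.add_const u)).integral_prod_left

/-- The error of `w` is at most twice the error averaged over the standard Gaussian centred at a
nonnegative multiple of `w`. -/
lemma zeroOneError_le_two_mul_integral (hD : ∀ᵐ z ∂D, z.2 = -1 ∨ z.2 = 1)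
    (w : EuclideanSpace ℝ (Fin d)) {c : ℝ} (hc : 0 ≤ c) :
    zeroOneError D w ≤
      2 * ∫ v, ∫ z, linearError z (v + c • w) ∂D ∂gaussianPrior (EuclideanSpace ℝ (Fin d)) := by
  have h1 : Integrable (fun z => linearError z w) D :=
    integrable_linearError D measurable_id measurable_const
  have h2 : Integrable (fun z => ∫ v, linearError z (v + c • w)
      ∂gaussianPrior (EuclideanSpace ℝ (Fin d))) D :=
    (integrable_linearError (D.prod (gaussianPrior (EuclideanSpace ℝ (Fin d))))
      measurable_fst (measurable_snd.add_const (c • w))).integral_prod_left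
  have h3 := integral_integral_swap (f := fun v z => linearError z (v + c • w))
    (integrable_linearError ((gaussianPrior (EuclideanSpace ℝ (Fin d))).prod D)
      measurable_snd (measurable_fst.add_const (c • w)))
  rw [h3, ← integral_const_mul]
  exact (zeroOneError_le_integral_linearError D hD w).trans
    (integral_mono h1 (h2.const_mul 2) fun z => linearError_le_two_mul_integral z w hc)

lemma sum_integral_linearError_le {S : Fin m → EuclideanSpace ℝ (Fin d) × ℝ} (hm : 1 ≤ m)
    (hS : ∀ i, ‖(S i).2 • (S i).1‖ ≤ 1) (w : EuclideanSpace ℝ (Fin d)) {c : ℝ} (hc : 0 ≤ c) :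
    ∑ i, ∫ v, linearError (S i) (v + c • w) ∂gaussianPrior (EuclideanSpace ℝ (Fin d)) ≤
      m * (Real.exp (-c ^ 2 / 2) + 4 * logisticEmpiricalRisk S w) := by
  have hm0 : (m : ℝ) ≠ 0 := by exact_mod_cast (by omega : m ≠ 0)
  refine (Finset.sum_le_sum fun i _ => integral_linearError_le (hS i) w hc).trans_eq ?_
  rw [Finset.sum_add_distrib, ← Finset.mul_sum, Finset.sum_const, Finset.card_univ,
    Fintype.card_fin, nsmul_eq_mul, logisticEmpiricalRisk]
  field_simp

lemma integral_riskGap_shift (S : Fin m → EuclideanSpace ℝ (Fin d) × ℝ)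
    (u : EuclideanSpace ℝ (Fin d)) :
    ∫ v, riskGap D linearError S (v + u) ∂gaussianPrior (EuclideanSpace ℝ (Fin d)) =
      (1 - Real.exp (-1)) *
          (m * ∫ v, ∫ z, linearError z (v + u) ∂D ∂gaussianPrior (EuclideanSpace ℝ (Fin d))) -
        ∑ i, ∫ v, linearError (S i) (v + u) ∂gaussianPrior (EuclideanSpace ℝ (Fin d)) := by
  have hi (i : Fin m) : Integrable (fun v => linearError (S i) (v + u))
      (gaussianPrior (EuclideanSpace ℝ (Fin d))) :=
    integrable_linearError _ measurable_const (measurable_add_const u)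
  simp only [riskGap]
  rw [integral_sub (((integrable_integral_linearError_shift D u).const_mul _).const_mul _)
      (integrable_finsetSum _ fun i _ => hi i),
    integral_const_mul, integral_const_mul, integral_finsetSum _ fun i _ => hi i]

/-- The 0-1 error of every linear classifier is controlled by its logistic empirical risk and its
norm, as soon as the prior average of `exp (riskGap)` is at most `1 / δ`. -/
lemma zeroOneError_le_of_riskGap (hD : ∀ᵐ z ∂D, z.2 = -1 ∨ z.2 = 1) (hm : 1 ≤ m)
    {S : Fin m → EuclideanSpace ℝ (Fin d) × ℝ} (hS : ∀ i, ‖(S i).2 • (S i).1‖ ≤ 1) {δ : ℝ}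
    (hδ : 0 < δ)
    (hgap : ∫ v, Real.exp (riskGap D linearError S v) ∂gaussianPrior (EuclideanSpace ℝ (Fin d)) ≤
      1 / δ) (w : EuclideanSpace ℝ (Fin d)) {c : ℝ} (hc : 0 ≤ c) :
    zeroOneError D w ≤ 4 * (Real.exp (-c ^ 2 / 2) + 4 * logisticEmpiricalRisk S w +
      (c ^ 2 * ‖w‖ ^ 2 / 2 + Real.log (1 / δ)) / m) := by
  have hm0 : (0 : ℝ) < m := by exact_mod_cast hm
  have hpop := zeroOneError_le_two_mul_integral D hD w hc
  have hemp := sum_integral_linearError_le hm hS w hc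
  have hshift := (exp_integral_shift_le (F := riskGap D linearError S)
    (measurable_riskGap_right D measurable_linearError S)
    (abs_riskGap_le D linearError_nonneg linearError_le_one S) (c • w)).trans hgap
  rw [← Real.le_log_iff_exp_le (by positivity), norm_smul, Real.norm_of_nonneg hc, mul_pow,
    integral_riskGap_shift] at hshift
  have hI0 : 0 ≤ ∫ v, ∫ z, linearError z (v + c • w) ∂D
      ∂gaussianPrior (EuclideanSpace ℝ (Fin d)) :=
    integral_nonneg fun v => integral_nonneg fun z => linearError_nonneg _ _
  generalize ∫ v, ∫ z, linearError z (v + c • w) ∂D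
    ∂gaussianPrior (EuclideanSpace ℝ (Fin d)) = I at hpop hshift hI0
  generalize ∑ i, ∫ v, linearError (S i) (v + c • w)
    ∂gaussianPrior (EuclideanSpace ℝ (Fin d)) = J at hemp hshift
  have he : 1 / 2 * (m * I) ≤ (1 - Real.exp (-1)) * (m * I) := by
    gcongr
    linarith [exp_neg_one_le_half]
  have hI : I / 2 ≤ Real.exp (-c ^ 2 / 2) + 4 * logisticEmpiricalRisk S w +
      (c ^ 2 * ‖w‖ ^ 2 / 2 + Real.log (1 / δ)) / m := by
    rw [← mul_le_mul_iff_right₀ hm0, mul_add, mul_div_cancel₀ _ hm0.ne']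
    linarith
  linarith

end MarginBound

/-! ### The error of gradient descent -/

lemma one_le_log_exp_one_add {x : ℝ} (hx : 0 ≤ x) : 1 ≤ Real.log (Real.exp 1 + x) := by
  rw [Real.le_log_iff_exp_le (by positivity)]
  linarith

lemma log_factor_bound {A B G p q : ℝ} (hA : 1 ≤ A) (hB : 1 ≤ B) (hG : 1 ≤ G) (hp : 0 ≤ p)
    (hq : 0 ≤ q) :
    4 * (q + 4 * (3 * B ^ 2 * p) + (8 * A * B ^ 2 + G) * q) ≤
      48 * (A * B * G) ^ 2 * (p + q) := by
  have hA2 : A ≤ A ^ 2 := le_self_pow₀ hA two_ne_zero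
  have hG2 : G ≤ G ^ 2 := le_self_pow₀ hG two_ne_zero
  have hB2 : 1 ≤ B ^ 2 := one_le_pow₀ hB
  have hABQ : A * B ^ 2 ≤ (A * B * G) ^ 2 := by
    calc A * B ^ 2 ≤ A ^ 2 * B ^ 2 := by gcongr
      _ ≤ A ^ 2 * B ^ 2 * G ^ 2 := le_mul_of_one_le_right (by positivity) (hG.trans hG2)
      _ = (A * B * G) ^ 2 := by ring
  have hBQ : B ^ 2 ≤ (A * B * G) ^ 2 := le_trans (le_mul_of_one_le_left (by positivity) hA) hABQ
  have hGQ : G ≤ (A * B * G) ^ 2 := by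
    calc G ≤ G ^ 2 := hG2
      _ ≤ (A ^ 2 * B ^ 2) * G ^ 2 := le_mul_of_one_le_left (by positivity)
          (one_le_mul_of_one_le_of_one_le (hA.trans hA2) hB2)
      _ = (A * B * G) ^ 2 := by ring
  have e1 := mul_le_mul_of_nonneg_right hBQ hp
  have e2 := mul_le_mul_of_nonneg_right hABQ hq
  have e3 := mul_le_mul_of_nonneg_right hGQ hq
  have e4 := mul_le_mul_of_nonneg_right (hB2.trans hBQ) hq
  linarith

/-- The error bound for gradient descent on a separable sample in the event that the prior average
of `exp (riskGap)` is at most `1 / δ`. -/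
lemma zeroOneError_gradientDescent_le {d m : ℕ} (D : Measure (EuclideanSpace ℝ (Fin d) × ℝ))
    [IsProbabilityMeasure D] (hD : ∀ᵐ z ∂D, z.2 = -1 ∨ z.2 = 1) (hm : 1 ≤ m)
    {S : Fin m → EuclideanSpace ℝ (Fin d) × ℝ} (hS : ∀ i, ‖(S i).2 • (S i).1‖ ≤ 1)
    {γ : ℝ} (hγ : 0 < γ) (hγ1 : γ ≤ 1) {w₀ : EuclideanSpace ℝ (Fin d)} (hw₀ : ‖w₀‖ = 1)
    (hsep : ∀ i, γ ≤ (S i).2 * inner ℝ (S i).1 w₀) {δ : ℝ} (hδ : 0 < δ)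
    (hgap : ∫ v, Real.exp (riskGap D linearError S v) ∂gaussianPrior (EuclideanSpace ℝ (Fin d)) ≤
      1 / δ) {T : ℕ} (hT : 1 ≤ T) :
    zeroOneError D (gradientDescent (logisticEmpiricalRisk S) (fun _ => 1) 0 T) ≤
      48 * (Real.log (Real.exp 1 + γ ^ 2 * m) * Real.log (Real.exp 1 + T) *
        Real.log (Real.exp 1 + 1 / δ)) ^ 2 * (1 / (γ ^ 2 * T) + 1 / (γ ^ 2 * m)) := by
  have hm0 : (0 : ℝ) < m := by exact_mod_cast hm
  have hT0 : (0 : ℝ) < T := by exact_mod_cast hT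
  obtain ⟨hrisk, hnorm⟩ := gradientDescent_separable hw₀ hγ hγ1 hS hsep hT
  set w := gradientDescent (logisticEmpiricalRisk S) (fun _ => 1) 0 T
  have hA := one_le_log_exp_one_add (show 0 ≤ γ ^ 2 * m by positivity)
  have hB := one_le_log_exp_one_add hT0.le
  have hG := one_le_log_exp_one_add (one_div_pos.2 hδ).le
  have hlog : Real.log (1 / δ) ≤ Real.log (Real.exp 1 + 1 / δ) :=
    Real.log_le_log (by positivity) (by linarith [Real.exp_pos 1])
  -- With this scale the Gaussian tail `exp (-c² / 2)` is `1 / (e + γ² m)`.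
  have hmain := zeroOneError_le_of_riskGap D hD hm hS hδ hgap w
    (Real.sqrt_nonneg (2 * Real.log (Real.exp 1 + γ ^ 2 * m)))
  rw [Real.sq_sqrt (by linarith), neg_div, mul_div_cancel_left₀ _ two_ne_zero, Real.exp_neg,
    Real.exp_log (by positivity)] at hmain
  set A := Real.log (Real.exp 1 + γ ^ 2 * m)
  set B := Real.log (Real.exp 1 + T)
  set G := Real.log (Real.exp 1 + 1 / δ)
  set p := 1 / (γ ^ 2 * T) with hp
  set q := 1 / (γ ^ 2 * m) with hq
  have hp0 : 0 < p := by positivity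
  have hq0 : 0 < q := by positivity
  have htail : (Real.exp 1 + γ ^ 2 * m)⁻¹ ≤ q := by
    rw [hq, one_div]
    gcongr
    linarith [Real.exp_pos 1]
  have hcomplexity : (2 * A * ‖w‖ ^ 2 / 2 + Real.log (1 / δ)) / m ≤ (8 * A * B ^ 2 + G) * q := by
    have h1 : Real.log (1 / δ) ≤ G / γ ^ 2 := by
      rw [le_div_iff₀ (by positivity)]
      have : γ ^ 2 ≤ 1 := by nlinarith
      nlinarith
    have h2 : 2 * A * ‖w‖ ^ 2 / 2 ≤ A * (8 * B ^ 2 / γ ^ 2) := by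
      have : A * ‖w‖ ^ 2 ≤ A * (8 * B ^ 2 / γ ^ 2) := by gcongr
      linarith
    calc (2 * A * ‖w‖ ^ 2 / 2 + Real.log (1 / δ)) / m
        ≤ (A * (8 * B ^ 2 / γ ^ 2) + G / γ ^ 2) / m := by gcongr
      _ = (8 * A * B ^ 2 + G) * q := by rw [hq]; field_simp
  refine le_trans ?_ (log_factor_bound hA hB hG hp0.le hq0.le)
  linarith

theorem mainTheorem2 :
    ∃ (C : ℝ) (k : ℕ), 0 < C ∧
      ∀ (d : ℕ) (D : Measure (EuclideanSpace ℝ (Fin d) × ℝ)) [IsProbabilityMeasure D]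
        (w₀ : EuclideanSpace ℝ (Fin d)) (γ : ℝ) (m : ℕ) (δ : ℝ),
        (∀ᵐ z ∂D, ‖z.1‖ ≤ 1 ∧ (z.2 = -1 ∨ z.2 = 1)) →
        ‖w₀‖ = 1 → 0 < γ →
        (∀ᵐ z ∂D, γ ≤ z.2 * inner ℝ z.1 w₀) →
        1 ≤ m → 0 < δ → δ < 1 →
        1 - δ ≤ (Measure.pi fun _ : Fin m => D).real
          {S | ∀ T : ℕ, 1 ≤ T →
            zeroOneError D (gradientDescent (logisticEmpiricalRisk S) (fun _ => 1) 0 T) ≤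
              C * (Real.log (Real.exp 1 + γ ^ 2 * m) * Real.log (Real.exp 1 + T) *
                  Real.log (Real.exp 1 + 1 / δ)) ^ k *
                (1 / (γ ^ 2 * T) + 1 / (γ ^ 2 * m))} := by
  refine ⟨48, 2, by norm_num, ?_⟩
  intro d D _ w₀ γ m δ hD hw₀ hγ hsep hm hδ _
  have hnorm : ∀ᵐ z ∂D, ‖z.2 • z.1‖ ≤ 1 := by
    filter_upwards [hD] with z hz
    rw [norm_smul]
    rcases hz.2 with h | h <;> simpa [h] using hz.1
  have hγ1 : γ ≤ 1 := by
    obtain ⟨z, hz1, hz2⟩ := (hnorm.and hsep).exists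
    rw [← real_inner_smul_left] at hz2
    have := real_inner_le_norm (z.2 • z.1) w₀
    rw [hw₀, mul_one] at this
    linarith
  set P := gaussianPrior (EuclideanSpace ℝ (Fin d))
  set bad : Set (Fin m → EuclideanSpace ℝ (Fin d) × ℝ) :=
    {S | 1 / δ ≤ ∫ v, Real.exp (riskGap D linearError S v) ∂P}
  have hbad : (Measure.pi fun _ : Fin m => D).real bad ≤ δ :=
    measureReal_exp_riskGap_ge_le D P measurable_linearError linearError_nonneg
      linearError_le_one m hδ
  have hsample : ∀ᵐ S ∂(Measure.pi fun _ : Fin m => D),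
      ∀ i, ‖(S i).2 • (S i).1‖ ≤ 1 ∧ γ ≤ (S i).2 * inner ℝ (S i).1 w₀ :=
    ae_all_iff.2 fun i => (measurePreserving_eval (fun _ : Fin m => D) i).quasiMeasurePreserving.ae
      (hnorm.and hsep)
  set good := {S : Fin m → EuclideanSpace ℝ (Fin d) × ℝ | ∀ T : ℕ, 1 ≤ T →
    zeroOneError D (gradientDescent (logisticEmpiricalRisk S) (fun _ => 1) 0 T) ≤
      48 * (Real.log (Real.exp 1 + γ ^ 2 * m) * Real.log (Real.exp 1 + T) *
        Real.log (Real.exp 1 + 1 / δ)) ^ 2 * (1 / (γ ^ 2 * T) + 1 / (γ ^ 2 * m))}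
  have hcover : ∀ᵐ S ∂(Measure.pi fun _ : Fin m => D), S ∈ good ∪ bad := by
    filter_upwards [hsample] with S hS
    refine or_iff_not_imp_right.2 fun hgap T hT => ?_
    exact zeroOneError_gradientDescent_le D (hD.mono fun z hz => hz.2) hm (fun i => (hS i).1) hγ
      hγ1 hw₀ (fun i => (hS i).2) hδ (not_le.1 hgap).le hT
  have h1 : 1 ≤ (Measure.pi fun _ : Fin m => D).real (good ∪ bad) := by
    rw [← probReal_univ (μ := Measure.pi fun _ : Fin m => D)]
    exact ENNReal.toReal_mono (measure_ne_top _ _)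
      (measure_mono_ae (hcover.mono fun S hS _ => hS))
  have h2 := measureReal_union_le (μ := Measure.pi fun _ : Fin m => D) good bad
  linarith
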